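/- Let $p$ be a prime, let $F/\mathbb{Q}_p$ be a finite extension with ring of integers $\mathcal{O}_F$, let $\pi$ be a uniformizer of $\mathcal{O}_F$ and let $q$ be the cardinality of $\mathcal{O}_F/\pi\mathcal{O}_F$. Let $\Phi(t)\in\mathcal{O}_F[[t]]$ be a Lubin–Tate power series for $\pi$, i.e. $\Phi(t)\equiv \pi t \pmod{t^2}$ and $\Phi(t)\equiv t^q \pmod{\pi}$. For $\gamma\in\mathcal{O}_F$ let $[\gamma]_\Phi(t)\in\mathcal{O}_F[[t]]$ be the power series describing multiplication by $\gamma$ in the Lubin–Tate formal group of $\Phi$, i.e. the unique power series with $[\gamma]_\Phi(t)\equiv\gamma t \pmod{t^2}$ and $\Phi([\gamma]_\Phi(t))=[\gamma]_\Phi(\Phi(t))$. Let $k$ be a field of characteristic $p$ with a ring homomorphism $\mathcal{O}_F\to k$ (for example the residue field of a finite extension $K$ of $F$), let $D$ be a finite set, and put $$k((t_\bullet))=k[[t_d]]_{d\in D}\Big[\prod_{d\in D}t_d^{-1}\Big].$$ Let the group $\Gamma_\bullet=\prod_{d\in D}\mathcal{O}_F^\times$ act on $k((t_\bullet))$ by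 letting $(\gamma_d)_{d\in D}$ act through the substitution of $[\gamma_d]_\Phi(t_d)$ (with coefficients mapped to $k$) for $t_d$, for all $d\in D$. Then the only ideals of $k((t_\bullet))$ that are stable under $\Gamma_\bullet$ are $0$ and $k((t_\bullet))$. -/

import Mathlib

namespace LubinTate

open PowerSeries

/-- `Φ` is a Lubin--Tate (Frobenius) power series for `π`: with `q` the cardinality of `R / π R`,
`Φ(t) ≡ π t` modulo degree `2` and `Φ(t) ≡ t ^ q` modulo `π`. -/
structure IsFrobeniusSeries {R : Type*} [CommRing R] (π : R) (Φ : R⟦X⟧) : Prop where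
  constantCoeff_eq : PowerSeries.constantCoeff Φ = 0
  coeff_one_eq : PowerSeries.coeff 1 Φ = π
  coeff_modEq : ∀ n, PowerSeries.coeff n (Φ - X ^ Nat.card (R ⧸ Ideal.span {π})) ∈ Ideal.span {π}

/-- `f` is the power series `[a]_Φ`: `f(t) ≡ a t` modulo degree `2` and `Φ(f(t)) = f(Φ(t))`.
(In Mathlib, `Φ.subst f` is `Φ(f(t))`.) -/
structure IsScalarSeries {R : Type*} [CommRing R] (Φ : R⟦X⟧) (a : R) (f : R⟦X⟧) : Prop where
  constantCoeff_eq : PowerSeries.constantCoeff f = 0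
  coeff_one_eq : PowerSeries.coeff 1 f = a
  comm : Φ.subst f = f.subst Φ

section General

variable {R : Type*} [CommRing R]

theorem dvd_subst_sub {m : ℕ} {f g : R⟦X⟧} (Φ : R⟦X⟧) (hf : PowerSeries.constantCoeff f = 0)
    (hg : PowerSeries.constantCoeff g = 0) (h : X ^ m ∣ f - g) :
    (X ^ m : R⟦X⟧) ∣ Φ.subst f - Φ.subst g := by
  rw [X_pow_dvd_iff]
  intro n hn
  rw [map_sub, coeff_subst' (HasSubst.of_constantCoeff_zero' hf),
    coeff_subst' (HasSubst.of_constantCoeff_zero' hg), sub_eq_zero]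
  refine finsum_congr fun j => ?_
  have h2 := X_pow_dvd_iff.1 (h.trans (sub_dvd_pow_sub_pow f g j)) n hn
  rw [map_sub, sub_eq_zero] at h2
  rw [h2]

theorem subst_sub_dvd {m : ℕ} {Φ f g : R⟦X⟧} (hΦ : PowerSeries.constantCoeff Φ = 0)
    (h : X ^ m ∣ f - g) : (X ^ m : R⟦X⟧) ∣ f.subst Φ - g.subst Φ := by
  have sΦ : HasSubst Φ := HasSubst.of_constantCoeff_zero' hΦ
  obtain ⟨w, hw⟩ := h
  obtain ⟨v, hv⟩ := X_dvd_iff.2 hΦ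
  rw [← coe_substAlgHom sΦ, ← map_sub, hw, map_mul, map_pow, coe_substAlgHom, subst_X sΦ]
  exact Dvd.dvd.mul_right (pow_dvd_pow_of_dvd ⟨v, hv⟩ _) _

theorem exists_eq_X_sq (Φ : R⟦X⟧) (h0 : PowerSeries.constantCoeff Φ = 0) :
    ∃ Ψ : R⟦X⟧, Φ = C (PowerSeries.coeff 1 Φ) * X + X ^ 2 * Ψ := by
  have : (X ^ 2 : R⟦X⟧) ∣ Φ - C (PowerSeries.coeff 1 Φ) * X := by
    rw [X_pow_dvd_iff]
    intro n hn
    interval_cases n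
    · simp [h0]
    · simp
  obtain ⟨Ψ, hΨ⟩ := this
  exact ⟨Ψ, by rw [← hΨ]; ring⟩

theorem dvd_subst_add_sub {m : ℕ} (hm : 2 ≤ m) {Φ f : R⟦X⟧} (c : R)
    (hΦ : PowerSeries.constantCoeff Φ = 0) (hf : PowerSeries.constantCoeff f = 0) :
    (X ^ (m + 1) : R⟦X⟧) ∣
      (((f + C c * X ^ m).subst Φ - Φ.subst (f + C c * X ^ m)) - (f.subst Φ - Φ.subst f))
        - C (c * (PowerSeries.coeff 1 Φ ^ m - PowerSeries.coeff 1 Φ)) * X ^ m := by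
  obtain ⟨Ψ, hΨ⟩ := exists_eq_X_sq Φ hΦ
  set π := PowerSeries.coeff 1 Φ with hπ
  set g : R⟦X⟧ := f + C c * X ^ m with hg
  have hg0 : PowerSeries.constantCoeff g = 0 := by
    simp [hg, hf, show m ≠ 0 by omega]
  have sΦ : HasSubst Φ := HasSubst.of_constantCoeff_zero' hΦ
  have key : ∀ h : R⟦X⟧, PowerSeries.constantCoeff h = 0 →
      (Φ.subst h : R⟦X⟧) = C π * h + h ^ 2 * (Ψ.subst h : R⟦X⟧) := by
    intro h hh
    have sh : HasSubst h := HasSubst.of_constantCoeff_zero' hh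
    conv_lhs => rw [hΨ]
    rw [subst_add sh, subst_mul sh, subst_mul sh, subst_pow sh, subst_X sh]
    congr 2
    exact subst_C π
  have h1 : (g.subst Φ : R⟦X⟧) = f.subst Φ + C c * Φ ^ m := by
    rw [hg, subst_add sΦ, subst_mul sΦ, subst_pow sΦ, subst_X sΦ]
    congr 2
    exact subst_C c
  obtain ⟨u, hu⟩ := X_dvd_iff.2 hf
  obtain ⟨w, hw⟩ := dvd_subst_sub (m := m) Ψ hg0 hf (by rw [hg]; exact ⟨C c, by ring⟩)
  obtain ⟨v, hv⟩ := sub_dvd_pow_sub_pow (C π + X * Ψ) (C π) m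
  have h2 : (Φ : R⟦X⟧) ^ m = X ^ m * (C π ^ m + X * Ψ * v) := by
    have : (C π + X * Ψ) ^ m = C π ^ m + X * Ψ * v := by
      linear_combination hv
    rw [← this, ← mul_pow]
    congr 1
    conv_lhs => rw [hΨ]
    ring
  have h3 : (Ψ.subst g : R⟦X⟧) = Ψ.subst f + X ^ m * w := by rw [← hw]; ring
  obtain ⟨r, rfl⟩ : ∃ r, m = r + 1 := ⟨m - 1, by omega⟩
  rw [key g hg0, key f hf, h1, h2, h3]
  rw [hg, hu, map_mul, map_sub, map_pow]
  refine ⟨C c * Ψ * v - (2 * u + C c * X ^ r) * C c * (Ψ.subst (X * u) + X ^ (r + 1) * w) - u ^ 2 * X * w, ?_⟩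
  ring

theorem exists_unit_aux [IsDomain R] {π : R} (hu : ∀ n ≠ 0, IsUnit (1 - π ^ n))
    (hfr : ∀ h : (R ⧸ Ideal.span {π})⟦X⟧,
      h.subst (X ^ Nat.card (R ⧸ Ideal.span {π}) : (R ⧸ Ideal.span {π})⟦X⟧)
        = h ^ Nat.card (R ⧸ Ideal.span {π}))
    {Φ : R⟦X⟧} (hΦ : IsFrobeniusSeries π Φ) {m : ℕ} (hm : 2 ≤ m) {f : R⟦X⟧}
    (hf : PowerSeries.constantCoeff f = 0) (hd : X ^ m ∣ f.subst Φ - Φ.subst f) :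
    ∃ c : R, X ^ (m + 1) ∣ (f + C c * X ^ m).subst Φ - Φ.subst (f + C c * X ^ m) := by
  set E : R⟦X⟧ := f.subst Φ - Φ.subst f with hE
  have sΦ : HasSubst Φ := HasSubst.of_constantCoeff_zero' hΦ.constantCoeff_eq
  have sf : HasSubst f := HasSubst.of_constantCoeff_zero' hf
  have hmapΦ : PowerSeries.map (Ideal.Quotient.mk (Ideal.span {π})) Φ
      = X ^ Nat.card (R ⧸ Ideal.span {π}) := by
    ext n
    have := Ideal.Quotient.eq_zero_iff_mem.2 (hΦ.coeff_modEq n)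
    rw [map_sub, map_sub, sub_eq_zero] at this
    rw [coeff_map, this]
    simp only [coeff_X_pow]
    split_ifs <;> simp
  have hmap : PowerSeries.map (Ideal.Quotient.mk (Ideal.span {π})) E = 0 := by
    rw [hE, map_sub, sub_eq_zero]
    change MvPowerSeries.map _ _ = MvPowerSeries.map _ _
    rw [PowerSeries.map_subst sΦ, PowerSeries.map_subst sf]
    change PowerSeries.subst (PowerSeries.map _ Φ) (PowerSeries.map _ f)
      = PowerSeries.subst (PowerSeries.map _ f) (PowerSeries.map _ Φ)
    rw [hmapΦ, hfr]
    have s2 : HasSubst (PowerSeries.map (Ideal.Quotient.mk (Ideal.span {π})) f) :=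
      HasSubst.of_constantCoeff_zero' (by
        rw [← coeff_zero_eq_constantCoeff_apply, coeff_map, coeff_zero_eq_constantCoeff_apply, hf,
          map_zero])
    rw [subst_pow s2, subst_X s2]
  have he : PowerSeries.coeff m E ∈ Ideal.span {π} := by
    rw [← Ideal.Quotient.eq_zero_iff_mem, ← coeff_map, hmap, map_zero]
  obtain ⟨e, he⟩ := Ideal.mem_span_singleton.1 he
  obtain ⟨u, hu⟩ := hu (m - 1) (by omega)
  refine ⟨e * ↑u⁻¹, ?_⟩
  have h1 := dvd_subst_add_sub hm (e * ↑u⁻¹) hΦ.constantCoeff_eq hf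
  rw [hΦ.coeff_one_eq, ← hE] at h1
  have h2 : (X ^ (m + 1) : R⟦X⟧) ∣ E - C (PowerSeries.coeff m E) * X ^ m := by
    rw [X_pow_dvd_iff]
    intro n hn
    rw [map_sub, coeff_C_mul, coeff_X_pow]
    rcases Nat.lt_succ_iff_lt_or_eq.1 hn with h | rfl
    · rw [X_pow_dvd_iff.1 hd n h, if_neg h.ne]; simp
    · simp
  have h3 : e * ↑u⁻¹ * (π ^ m - π) = - PowerSeries.coeff m E := by
    obtain ⟨r, rfl⟩ : ∃ r, m = r + 1 := ⟨m - 1, by omega⟩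
    have : π ^ (r + 1) - π = - (π * u) := by rw [hu]; simp; ring
    rw [this, he]
    linear_combination (- π * e) * u.inv_mul
  rw [h3] at h1
  have := dvd_add h1 h2
  convert this using 1
  rw [map_neg]
  ring

/-- The Lubin--Tate lemma. -/
theorem existsUnique_isScalarSeries [IsDomain R] {π : R} (h0 : π ≠ 0)
    (hu : ∀ n ≠ 0, IsUnit (1 - π ^ n))
    (hfr : ∀ h : (R ⧸ Ideal.span {π})⟦X⟧,
      h.subst (X ^ Nat.card (R ⧸ Ideal.span {π}) : (R ⧸ Ideal.span {π})⟦X⟧)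
        = h ^ Nat.card (R ⧸ Ideal.span {π}))
    {Φ : R⟦X⟧} (hΦ : IsFrobeniusSeries π Φ) (a : R) : ∃! f, IsScalarSeries Φ a f := by
  have sΦ : HasSubst Φ := HasSubst.of_constantCoeff_zero' hΦ.constantCoeff_eq
  refine existsUnique_of_exists_of_unique ?_ ?_
  · let P : ℕ → R⟦X⟧ → Prop := fun n f => PowerSeries.constantCoeff f = 0 ∧
      PowerSeries.coeff 1 f = a ∧ X ^ (n + 2) ∣ f.subst Φ - Φ.subst f
    have base : P 0 (C a * X) := by
      refine ⟨by simp, by simp, ?_⟩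
      obtain ⟨Ψ, hΨ⟩ := exists_eq_X_sq Φ hΦ.constantCoeff_eq
      have sf : HasSubst (C a * X : R⟦X⟧) := HasSubst.of_constantCoeff_zero' (by simp)
      have e1 : ((C a * X : R⟦X⟧).subst Φ : R⟦X⟧) = C a * Φ := by
        rw [subst_mul sΦ, subst_X sΦ]
        congr 1
        exact subst_C a
      have e2 : (Φ.subst (C a * X : R⟦X⟧) : R⟦X⟧) = C (PowerSeries.coeff 1 Φ) * (C a * X)
          + (C a * X) ^ 2 * Ψ.subst (C a * X : R⟦X⟧) := by
        conv_lhs => rw [hΨ]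
        rw [subst_add sf, subst_mul sf, subst_mul sf, subst_pow sf, subst_X sf]
        congr 2
        exact subst_C _
      rw [e1, e2]
      refine ⟨C a * Ψ - C a ^ 2 * Ψ.subst (C a * X : R⟦X⟧), ?_⟩
      conv_lhs => enter [1, 2]; rw [hΨ]
      ring
    have step : ∀ n f, P n f → ∃ c : R, P (n + 1) (f + C c * X ^ (n + 2)) := by
      rintro n f ⟨h1, h2, h3⟩
      obtain ⟨c, hc⟩ := exists_unit_aux hu hfr hΦ (by omega) h1 h3
      refine ⟨c, by simp [h1], ?_, hc⟩
      simp [h2, coeff_X_pow]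
    choose! c hc using step
    let s : ℕ → R⟦X⟧ := fun n => Nat.rec (C a * X) (fun n f => f + C (c n f) * X ^ (n + 2)) n
    have hs : ∀ n, P n (s n) := fun n => by
      induction n with
      | zero => exact base
      | succ n ih => exact hc n _ ih
    have hstab : ∀ n k, X ^ (n + 2) ∣ s (n + k) - s n := fun n k => by
      induction k with
      | zero => simp
      | succ k ih =>
        have : s (n + (k + 1)) = s (n + k) + C (c (n + k) (s (n + k))) * X ^ (n + k + 2) := rfl
        rw [this, add_sub_right_comm]
        refine dvd_add ih (Dvd.dvd.mul_left (pow_dvd_pow _ (by omega)) _)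
    let f : R⟦X⟧ := PowerSeries.mk fun n => PowerSeries.coeff n (s n)
    have hfs : ∀ n, X ^ (n + 2) ∣ s n - f := fun n => by
      rw [X_pow_dvd_iff]
      intro i hi
      rw [map_sub, coeff_mk, sub_eq_zero]
      rcases le_total i n with h | h
      · obtain ⟨k, rfl⟩ := Nat.exists_eq_add_of_le h
        have := X_pow_dvd_iff.1 (hstab i k) i (by omega)
        rwa [map_sub, sub_eq_zero] at this
      · obtain ⟨k, rfl⟩ := Nat.exists_eq_add_of_le h
        have := X_pow_dvd_iff.1 (hstab n k) (n + k) (by omega)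
        rw [map_sub, sub_eq_zero] at this
        exact this.symm
    have hf0 : PowerSeries.constantCoeff f = 0 := by
      rw [← coeff_zero_eq_constantCoeff_apply, coeff_mk, coeff_zero_eq_constantCoeff_apply]
      exact (hs 0).1
    refine ⟨f, hf0, by rw [coeff_mk]; exact (hs 1).2.1, ?_⟩
    rw [← sub_eq_zero]
    ext n
    have d1 := dvd_subst_sub Φ (hs n).1 hf0 (hfs n)
    have d2 := subst_sub_dvd hΦ.constantCoeff_eq (hfs n)
    have d3 := dvd_sub (dvd_sub (hs n).2.2 d2) (d1.neg_right)
    have := X_pow_dvd_iff.1 d3 n (by omega)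
    rw [map_zero]
    rw [← neg_eq_zero, ← map_neg, ← this]
    congr 1
    ring
  · intro f g hf hg
    have main : ∀ m, X ^ (m + 2) ∣ g - f := fun m => by
      induction m with
      | zero =>
        rw [X_pow_dvd_iff]
        intro n hn
        interval_cases n
        · simp [hf.constantCoeff_eq, hg.constantCoeff_eq]
        · rw [map_sub, hf.coeff_one_eq, hg.coeff_one_eq, sub_self]
      | succ m ih =>
        set c := PowerSeries.coeff (m + 2) (g - f) with hc
        have hd : X ^ (m + 3) ∣ g - (f + C c * X ^ (m + 2)) := by
          rw [X_pow_dvd_iff]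
          intro n hn
          rw [← sub_sub, map_sub, coeff_C_mul, coeff_X_pow]
          rcases Nat.lt_succ_iff_lt_or_eq.1 hn with h | rfl
          · rw [X_pow_dvd_iff.1 ih n h, if_neg h.ne]; simp
          · simp [hc]
        have d1 := dvd_subst_add_sub (show 2 ≤ m + 2 by omega) c hΦ.constantCoeff_eq
          hf.constantCoeff_eq
        have d2 := dvd_subst_sub Φ hg.constantCoeff_eq (by simp [hf.constantCoeff_eq]) hd
        have d3 := subst_sub_dvd hΦ.constantCoeff_eq hd
        rw [← hf.comm, sub_self, sub_zero, hΦ.coeff_one_eq] at d1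
        rw [hg.comm] at d2
        have d4 := X_pow_dvd_iff.1 ((dvd_sub d3 d2).add d1) (m + 2) (by omega)
        have d5 : c * (π ^ (m + 2) - π) = 0 := by
          rw [← neg_eq_zero, ← d4]
          have : ∀ A B D : R⟦X⟧, A - B - (A - D) + (B - D - C (c * (π ^ (m + 2) - π)) *
            X ^ (m + 2)) = - (C (c * (π ^ (m + 2) - π)) * X ^ (m + 2)) := by intros; ring
          rw [this, map_neg, coeff_C_mul, coeff_X_pow_self, mul_one]
        have d6 : c = 0 := by
          have : π ^ (m + 2) - π = - (π * (1 - π ^ (m + 1))) := by ring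
          rw [this, mul_eq_zero, neg_eq_zero, mul_eq_zero] at d5
          rcases d5 with h | h | h
          · exact h
          · exact absurd h h0
          · exact absurd h (hu (m + 1) (by omega)).ne_zero
        rw [d6] at hd
        simpa using hd
    ext n
    have := X_pow_dvd_iff.1 (main n) n (by omega)
    rw [map_sub, sub_eq_zero] at this
    exact this.symm

theorem subst_X_pow_card {k : Type*} [Field k] [Finite k] (h : k⟦X⟧) :
    h.subst (X ^ Nat.card k : k⟦X⟧) = h ^ Nat.card k := by
  have := Fintype.ofFinite k
  obtain ⟨p, hp⟩ := CharP.exists k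
  obtain ⟨n, hpr, hn⟩ := FiniteField.card k p
  have := Fact.mk hpr
  rw [Nat.card_eq_fintype_card]
  have e : iterateFrobenius k p n = RingHom.id k := by
    ext x
    rw [iterateFrobenius_def, ← hn, FiniteField.pow_card, RingHom.id_apply]
  have := MvPowerSeries.map_iterateFrobenius_expand p hpr.ne_zero h n
  rw [e] at this
  have h2 : (PowerSeries.expand (p ^ (n : ℕ)) (pow_ne_zero _ hpr.ne_zero) h) = h ^ p ^ (n : ℕ) := by
    rw [← this]
    ext; simp [PowerSeries.expand]
  rw [hn, ← h2, expand_apply]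

end General

/-! ### The scalar multiplications of a Lubin--Tate group -/

section Padic

variable (p : ℕ) [Fact p.Prime] (F : Type*) [Field F] [Algebra ℚ_[p] F] [FiniteDimensional ℚ_[p] F]
  [Algebra ℤ_[p] F] [IsScalarTower ℤ_[p] ℚ_[p] F]

theorem isIntegral_iff (x : F) : IsIntegral ℤ_[p] x ↔ spectralNorm ℚ_[p] F x ≤ 1 := by
  have hx : IsIntegral ℚ_[p] x := Algebra.IsIntegral.isIntegral x
  rw [spectralNorm, spectralValue_le_one_iff (minpoly.monic hx)]
  constructor
  · intro h n
    rw [minpoly.isIntegrallyClosed_eq_field_fractions' ℚ_[p] h, Polynomial.coeff_map]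
    exact PadicInt.norm_le_one _
  · intro h
    have : minpoly ℚ_[p] x ∈ Polynomial.lifts (algebraMap ℤ_[p] ℚ_[p]) := by
      rw [Polynomial.lifts_iff_coeff_lifts]
      intro n
      exact ⟨⟨_, h n⟩, rfl⟩
    obtain ⟨q, hq, hd, hm⟩ := Polynomial.lifts_and_natDegree_eq_and_monic this (minpoly.monic hx)
    refine ⟨q, hm, ?_⟩
    rw [IsScalarTower.algebraMap_eq ℤ_[p] ℚ_[p] F, ← Polynomial.eval₂_map, hq]
    exact minpoly.aeval _ _

theorem isLocalRing_integralClosure : IsLocalRing (integralClosure ℤ_[p] F) := by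
  have key : ∀ x : integralClosure ℤ_[p] F, x ∈ nonunits _ ↔ spectralNorm ℚ_[p] F x < 1 := by
    intro x
    have hmul := fun a b => map_mul (spectralMulAlgNorm ℚ_[p] F) a b
    have h1 : spectralNorm ℚ_[p] F 1 = 1 := spectralNorm_one ..
    simp only [spectralMulAlgNorm_def] at hmul
    have hx := (isIntegral_iff p F x).1 x.2
    rw [mem_nonunits_iff, ← not_iff_not, not_not, not_lt]
    constructor
    · rintro ⟨u, rfl⟩
      have h2 := (isIntegral_iff p F _).1 (u⁻¹ : (integralClosure ℤ_[p] F)ˣ).1.2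
      have h3 := hmul (u : integralClosure ℤ_[p] F) ((u⁻¹ : (integralClosure ℤ_[p] F)ˣ) : integralClosure ℤ_[p] F)
      rw [← MulMemClass.coe_mul, u.mul_inv, OneMemClass.coe_one, h1] at h3
      have h4 := spectralNorm_nonneg (K := ℚ_[p]) (L := F) ((u : integralClosure ℤ_[p] F) : F)
      nlinarith
    · intro h
      have hx1 : spectralNorm ℚ_[p] F x = 1 := le_antisymm hx h
      have hx0 : (x : F) ≠ 0 := by
        intro h0
        rw [h0, spectralNorm_zero] at hx1
        exact zero_ne_one hx1
      have h3 := hmul x (x : F)⁻¹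
      rw [mul_inv_cancel₀ hx0, h1, hx1, one_mul] at h3
      have h4 : (x : F)⁻¹ ∈ integralClosure ℤ_[p] F := (isIntegral_iff p F _).2 h3.ge
      exact IsUnit.of_mul_eq_one ⟨_, h4⟩ (Subtype.ext (mul_inv_cancel₀ hx0))
  refine IsLocalRing.of_nonunits_add ?_
  intro a b ha hb
  rw [key] at *
  exact (isNonarchimedean_spectralNorm (K := ℚ_[p]) (L := F) a b).trans_lt (max_lt ha hb)

theorem isDiscreteValuationRing : IsDiscreteValuationRing (integralClosure ℤ_[p] F) := by
  have := isLocalRing_integralClosure p F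
  have : IsDedekindDomain (integralClosure ℤ_[p] F) :=
    IsIntegralClosure.isDedekindDomain ℤ_[p] ℚ_[p] F _
  have inj : Function.Injective (algebraMap ℤ_[p] F) := by
    rw [IsScalarTower.algebraMap_eq ℤ_[p] ℚ_[p] F]
    exact (algebraMap ℚ_[p] F).injective.comp (IsFractionRing.injective ℤ_[p] ℚ_[p])
  have : ¬ IsField (integralClosure ℤ_[p] F) := fun h =>
    IsDiscreteValuationRing.not_isField ℤ_[p] (isField_of_isIntegral_of_isField
      (fun x y hxy => inj (congrArg Subtype.val hxy)) h)
  exact ((IsDiscreteValuationRing.TFAE _ this).out 0 2).2 ‹IsDedekindDomain _›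

theorem isMaximal_and_finite {π : integralClosure ℤ_[p] F} (hπ : Irreducible π) :
    (Ideal.span {π}).IsMaximal ∧ Finite (integralClosure ℤ_[p] F ⧸ Ideal.span {π}) := by
  have := isDiscreteValuationRing p F
  have hm : (Ideal.span {π}).IsMaximal := by
    rw [← (IsDiscreteValuationRing.irreducible_iff_uniformizer π).1 hπ]
    infer_instance
  refine ⟨hm, ?_⟩
  have : Module.Finite ℤ_[p] (integralClosure ℤ_[p] F) :=
    IsIntegralClosure.finite ℤ_[p] ℚ_[p] F _
  have h2 : ((Ideal.span {π}).under ℤ_[p]).IsMaximal := Ideal.IsMaximal.under ℤ_[p] _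
  have h3 : Finite (ℤ_[p] ⧸ (Ideal.span {π}).under ℤ_[p]) := by
    rw [IsLocalRing.eq_maximalIdeal h2]
    exact Finite.of_injective (PadicInt.residueField (p := p))
      (PadicInt.residueField (p := p)).injective
  have : Module.Finite (ℤ_[p] ⧸ (Ideal.span {π}).under ℤ_[p])
    (integralClosure ℤ_[p] F ⧸ Ideal.span {π}) := inferInstance
  exact Module.finite_of_finite (ℤ_[p] ⧸ (Ideal.span {π}).under ℤ_[p])

variable {p F}

/-- For every `a` in `𝓞_F` there is exactly one power series over `𝓞_F` with linear term `a t` and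
commuting with `Φ`. -/
theorem existsUnique_bracket {π : integralClosure ℤ_[p] F} (hπ : Irreducible π)
    {Φ : (integralClosure ℤ_[p] F)⟦X⟧} (hΦ : IsFrobeniusSeries π Φ) (a : integralClosure ℤ_[p] F) :
    ∃! f, IsScalarSeries Φ a f := by
  have := isLocalRing_integralClosure p F
  obtain ⟨h1, h2⟩ := isMaximal_and_finite p F hπ
  refine existsUnique_isScalarSeries hπ.ne_zero ?_ ?_ hΦ a
  · intro n hn
    refine (IsLocalRing.isUnit_or_isUnit_one_sub_self (π ^ n)).resolve_left ?_
    rw [isUnit_pow_iff hn]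
    exact hπ.not_isUnit
  · let := Ideal.Quotient.field (Ideal.span {π})
    exact subst_X_pow_card

/-- The power series `[a]_Φ(t)` over `𝓞_F`, which describes multiplication by `a` in the Lubin--Tate
formal group of `Φ` (the formal group law over `𝓞_F` that has `Φ` as the endomorphism `[π]`): the
unique series with linear term `a t` commuting with `Φ`. -/
noncomputable def bracket {π : integralClosure ℤ_[p] F} (hπ : Irreducible π)
    {Φ : (integralClosure ℤ_[p] F)⟦X⟧} (hΦ : IsFrobeniusSeries π Φ) (a : integralClosure ℤ_[p] F) :
    (integralClosure ℤ_[p] F)⟦X⟧ :=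
  (existsUnique_bracket hπ hΦ a).choose

theorem bracket_spec {π : integralClosure ℤ_[p] F} (hπ : Irreducible π)
    {Φ : (integralClosure ℤ_[p] F)⟦X⟧} (hΦ : IsFrobeniusSeries π Φ)
    (a : integralClosure ℤ_[p] F) : IsScalarSeries Φ a (bracket hπ hΦ a) :=
  (existsUnique_bracket hπ hΦ a).choose_spec.1

theorem eq_bracket {π : integralClosure ℤ_[p] F} (hπ : Irreducible π)
    {Φ : (integralClosure ℤ_[p] F)⟦X⟧} (hΦ : IsFrobeniusSeries π Φ)
    {a : integralClosure ℤ_[p] F} {f : (integralClosure ℤ_[p] F)⟦X⟧} (hf : IsScalarSeries Φ a f) :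
    bracket hπ hΦ a = f :=
  (existsUnique_bracket hπ hΦ a).unique (bracket_spec hπ hΦ a) hf

theorem bracket_one {π : integralClosure ℤ_[p] F} (hπ : Irreducible π)
    {Φ : (integralClosure ℤ_[p] F)⟦X⟧} (hΦ : IsFrobeniusSeries π Φ) : bracket hπ hΦ 1 = X :=
  eq_bracket hπ hΦ ⟨by simp, by simp, by
    rw [X_subst, subst_X (HasSubst.of_constantCoeff_zero' hΦ.constantCoeff_eq)]⟩

theorem bracket_mul {π : integralClosure ℤ_[p] F} (hπ : Irreducible π)
    {Φ : (integralClosure ℤ_[p] F)⟦X⟧} (hΦ : IsFrobeniusSeries π Φ)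
    (a b : integralClosure ℤ_[p] F) :
    bracket hπ hΦ (a * b) = (bracket hπ hΦ a).subst (bracket hπ hΦ b) := by
  have ha := bracket_spec hπ hΦ a
  have hb := bracket_spec hπ hΦ b
  have sΦ : HasSubst Φ := HasSubst.of_constantCoeff_zero' hΦ.constantCoeff_eq
  have sa : HasSubst (bracket hπ hΦ a) := HasSubst.of_constantCoeff_zero' ha.constantCoeff_eq
  have sb : HasSubst (bracket hπ hΦ b) := HasSubst.of_constantCoeff_zero' hb.constantCoeff_eq
  obtain ⟨Ψ, hΨ⟩ := exists_eq_X_sq _ ha.constantCoeff_eq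
  obtain ⟨v, hv⟩ := X_dvd_iff.2 hb.constantCoeff_eq
  have e : ((bracket hπ hΦ a).subst (bracket hπ hΦ b) : (integralClosure ℤ_[p] F)⟦X⟧)
      = C a * bracket hπ hΦ b + X * (X * (v ^ 2 * Ψ.subst (bracket hπ hΦ b))) := by
    conv_lhs => rw [hΨ]
    rw [subst_add sb, subst_mul sb, subst_mul sb, subst_pow sb, subst_X sb, ha.coeff_one_eq]
    congr 1
    · congr 1
      exact subst_C a
    · conv_lhs => enter [1]; rw [hv]
      ring
  refine eq_bracket hπ hΦ ⟨?_, ?_, ?_⟩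
  · rw [e]; simp [hb.constantCoeff_eq]
  · rw [e, map_add, coeff_C_mul, hb.coeff_one_eq, ← zero_add 1, coeff_succ_X_mul, coeff_zero_X_mul,
      add_zero]
  · rw [← subst_comp_subst_apply sa sb, ha.comm, subst_comp_subst_apply sΦ sb, hb.comm,
      subst_comp_subst_apply sb sΦ]

/-- The ring `k((t_•)) = k[[t_d]]_{d ∈ D}[∏ t_d⁻¹]`. -/
abbrev LaurentRing (k : Type*) [Field k] (D : Type*) [Fintype D] : Type _ :=
  Localization.Away (∏ d : D, (MvPowerSeries.X d : MvPowerSeries D k))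

section Action

variable {π : integralClosure ℤ_[p] F} (hπ : Irreducible π)
  {Φ : (integralClosure ℤ_[p] F)⟦X⟧} (hΦ : IsFrobeniusSeries π Φ)
  {k : Type*} [Field k] (ι : integralClosure ℤ_[p] F →+* k) {D : Type*} [Fintype D]

/-- The power series `[γ]_Φ(t_d)` in `k[[t_•]]`, with coefficients reduced along `ι : 𝓞_F → k`. -/
noncomputable def imageVar (γ : (integralClosure ℤ_[p] F)ˣ) (d : D) : MvPowerSeries D k :=
  (PowerSeries.map ι (bracket hπ hΦ γ)).subst (MvPowerSeries.X d : MvPowerSeries D k)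

theorem exists_imageVar_eq (γ : (integralClosure ℤ_[p] F)ˣ) (d : D) :
    ∃ u : MvPowerSeries D k, IsUnit u ∧ imageVar hπ hΦ ι γ d = MvPowerSeries.X d * u := by
  have sX : HasSubst (MvPowerSeries.X d : MvPowerSeries D k) := HasSubst.X d
  have hs := bracket_spec hπ hΦ (γ : integralClosure ℤ_[p] F)
  obtain ⟨v, hv⟩ := X_dvd_iff.2 hs.constantCoeff_eq
  have hv0 : PowerSeries.constantCoeff v = γ := by
    rw [← hs.coeff_one_eq, hv, ← zero_add 1, coeff_succ_X_mul, coeff_zero_eq_constantCoeff_apply]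
  have hu : IsUnit (PowerSeries.map ι v) := by
    rw [PowerSeries.isUnit_iff_constantCoeff, ← coeff_zero_eq_constantCoeff_apply, coeff_map,
      coeff_zero_eq_constantCoeff_apply, hv0]
    exact γ.isUnit.map ι
  refine ⟨substAlgHom sX (PowerSeries.map ι v), hu.map _, ?_⟩
  rw [imageVar, hv, map_mul, PowerSeries.map_X, subst_mul sX, subst_X sX, coe_substAlgHom]

theorem hasSubst_imageVar (γ : D → (integralClosure ℤ_[p] F)ˣ) :
    MvPowerSeries.HasSubst fun d => (imageVar hπ hΦ ι (γ d) d : MvPowerSeries D k) := by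
  refine MvPowerSeries.hasSubst_of_constantCoeff_zero fun d => ?_
  obtain ⟨u, -, hu⟩ := exists_imageVar_eq (D := D) hπ hΦ ι (γ d) d
  rw [hu, map_mul, MvPowerSeries.constantCoeff_X, zero_mul]

/-- The action of `(γ_d)_d` on `k[[t_•]]`: the substitution `t_d ↦ [γ_d]_Φ(t_d)` for all `d`, identity
on `k`. -/
noncomputable def powerSeriesAction (γ : D → (integralClosure ℤ_[p] F)ˣ) :
    MvPowerSeries D k →+* MvPowerSeries D k :=
  (MvPowerSeries.substAlgHom (hasSubst_imageVar hπ hΦ ι γ)).toRingHom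

theorem isUnit_algebraMap_powerSeriesAction (γ : D → (integralClosure ℤ_[p] F)ˣ) :
    IsUnit (((algebraMap (MvPowerSeries D k) (LaurentRing k D)).comp
      (powerSeriesAction hπ hΦ ι γ)) (∏ d, MvPowerSeries.X d)) := by
  choose u hu h using fun d => exists_imageVar_eq (D := D) hπ hΦ ι (γ d) d
  have h1 : powerSeriesAction hπ hΦ ι γ (∏ d, MvPowerSeries.X d)
      = (∏ d, MvPowerSeries.X d) * ∏ d, u d := by
    rw [map_prod, ← Finset.prod_mul_distrib]
    refine Finset.prod_congr rfl fun d _ => ?_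
    rw [← h d]
    exact MvPowerSeries.substAlgHom_X (hasSubst_imageVar hπ hΦ ι γ) d
  rw [RingHom.comp_apply, h1, map_mul]
  refine (IsLocalization.Away.algebraMap_isUnit _).mul ?_
  have : IsUnit (∏ d, u d) := IsUnit.prod_univ_iff.2 hu
  exact this.map _

theorem subst_imageVar (γ : D → (integralClosure ℤ_[p] F)ˣ) (δ : (integralClosure ℤ_[p] F)ˣ)
    (d : D) :
    MvPowerSeries.subst (fun d => (imageVar hπ hΦ ι (γ d) d : MvPowerSeries D k))
      (imageVar hπ hΦ ι δ d : MvPowerSeries D k) = imageVar hπ hΦ ι (γ d * δ) d := by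
  have hγ := hasSubst_imageVar hπ hΦ ι γ
  have sX : HasSubst (MvPowerSeries.X d : MvPowerSeries D k) := HasSubst.X d
  have hb := bracket_spec hπ hΦ (γ d : integralClosure ℤ_[p] F)
  have sb := HasSubst.of_constantCoeff_zero' hb.constantCoeff_eq
  have sb' : HasSubst (PowerSeries.map ι (bracket hπ hΦ (γ d : integralClosure ℤ_[p] F))) :=
    HasSubst.of_constantCoeff_zero' (by
      rw [← coeff_zero_eq_constantCoeff_apply, coeff_map, coeff_zero_eq_constantCoeff_apply,
        hb.constantCoeff_eq, map_zero])
  have e : PowerSeries.map ι (bracket hπ hΦ ((γ d * δ : (integralClosure ℤ_[p] F)ˣ) :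
      integralClosure ℤ_[p] F)) = (PowerSeries.map ι (bracket hπ hΦ δ)).subst
        (PowerSeries.map ι (bracket hπ hΦ (γ d))) := by
    rw [Units.val_mul, mul_comm, bracket_mul]
    exact PowerSeries.map_subst sb _
  rw [imageVar, imageVar, e, subst_comp_subst_apply sb' sX, PowerSeries.subst_def,
    MvPowerSeries.subst_comp_subst_apply sX.const hγ, PowerSeries.subst_def]
  congr 1
  funext _
  exact MvPowerSeries.subst_X hγ d

theorem powerSeriesAction_one : powerSeriesAction hπ hΦ ι (1 : D → (integralClosure ℤ_[p] F)ˣ)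
    = RingHom.id (MvPowerSeries D k) := by
  ext1 f
  have : (fun d => (imageVar hπ hΦ ι 1 d : MvPowerSeries D k)) = MvPowerSeries.X := by
    funext d
    rw [imageVar, Units.val_one, bracket_one, PowerSeries.map_X, subst_X (HasSubst.X d)]
  change MvPowerSeries.substAlgHom (hasSubst_imageVar hπ hΦ ι 1) f = f
  rw [MvPowerSeries.coe_substAlgHom]
  change MvPowerSeries.subst (fun d => (imageVar hπ hΦ ι 1 d : MvPowerSeries D k)) f = f
  rw [this, MvPowerSeries.subst_self, id]

theorem powerSeriesAction_mul (γ δ : D → (integralClosure ℤ_[p] F)ˣ) :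
    (powerSeriesAction hπ hΦ ι (γ * δ) : MvPowerSeries D k →+* MvPowerSeries D k)
      = (powerSeriesAction hπ hΦ ι γ).comp (powerSeriesAction hπ hΦ ι δ) := by
  ext1 f
  change MvPowerSeries.substAlgHom (hasSubst_imageVar hπ hΦ ι (γ * δ)) f
    = MvPowerSeries.substAlgHom (hasSubst_imageVar hπ hΦ ι γ)
      (MvPowerSeries.substAlgHom (hasSubst_imageVar hπ hΦ ι δ) f)
  rw [MvPowerSeries.coe_substAlgHom, MvPowerSeries.coe_substAlgHom, MvPowerSeries.coe_substAlgHom,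
    MvPowerSeries.subst_comp_subst_apply (hasSubst_imageVar hπ hΦ ι δ)
      (hasSubst_imageVar hπ hΦ ι γ)]
  congr 1
  funext d
  exact (subst_imageVar hπ hΦ ι γ (δ d) d).symm

/-- The action of `Γ_• = ∏_{d ∈ D} 𝓞_F^×` on `k((t_•))` by ring endomorphisms, the extension of
`powerSeriesAction` to the localization. -/
noncomputable def action : (D → (integralClosure ℤ_[p] F)ˣ) →*
    (LaurentRing k D →+* LaurentRing k D) where
  toFun γ := IsLocalization.Away.lift (∏ d : D, (MvPowerSeries.X d : MvPowerSeries D k))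
    (isUnit_algebraMap_powerSeriesAction hπ hΦ ι γ)
  map_one' := by
    refine IsLocalization.ringHom_ext
      (Submonoid.powers (∏ d : D, (MvPowerSeries.X d : MvPowerSeries D k))) ?_
    rw [IsLocalization.Away.lift_comp, powerSeriesAction_one]
    rfl
  map_mul' γ δ := by
    refine IsLocalization.ringHom_ext
      (Submonoid.powers (∏ d : D, (MvPowerSeries.X d : MvPowerSeries D k))) ?_
    rw [IsLocalization.Away.lift_comp, powerSeriesAction_mul]
    ext1 f
    simp only [RingHom.comp_apply, RingHom.mul_def, IsLocalization.Away.lift_eq]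

end Action

end Padic
end LubinTate

/-! Contract the stable ideal to an ideal `J` of `k[[t_•]]`. It is stable under the substitutions,
and each `t_d` can be cancelled modulo `J` because `t_d` becomes invertible in `k((t_•))`. If `J`
contains some `f ≠ 0`, pick an exponent `e` occurring in `f` and set its entries to zero one
variable at a time, staying inside `J`. At the end `J` contains a series with nonzero constant term,
hence a unit.

To clear the entry `m = e d`, expand `f = ∑ c_i t_d ^ i` with `c_i` free of `t_d`, and let `m + 1`
distinct units `γ_j` act on the variable `t_d` alone. The `c_i` are fixed, so `J` contains `∑ c_i
h_j ^ i` with `h_j = [γ_j]_Φ(t_d)`. The Vandermonde determinant of the `h_j` is a nonzero series in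
`t_d` alone, hence a power of `t_d` times a unit, and it can be cancelled modulo `J`. Lagrange
interpolation then gives an element of `J` congruent to `c_m` modulo `t_d`
(`exists_mem_dvd_sub_coeff`, `exists_mem_coeff_erase_ne_zero`).

The determinant is nonzero because `a ↦ [a]_Φ` remains injective after reduction to `k`
(`eq_of_C_dvd_sub`, `map_bracket_injective`). -/

namespace LubinTate

/-! ### Interpolation modulo an ideal. -/

section Interpolation

open Polynomial in
/-- If an ideal `J` contains, up to multiples of `Δ x`, the values of a polynomial `P` at `m + 1`
nodes divisible by `x` whose Vandermonde determinant `Δ` can be cancelled modulo `J`, then `J`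
contains an element congruent modulo `x` to the coefficient of degree `m` of `P`. -/
theorem exists_mem_dvd_sub_coeff {R : Type*} [CommRing R] [Nontrivial R] {J : Ideal R} {x : R}
    {m : ℕ} (h : Fin (m + 1) → R) (hx : ∀ j, x ∣ h j)
    (hJ : ∀ g, (Matrix.vandermonde h).det * g ∈ J → g ∈ J) (P : R[X]) (r : Fin (m + 1) → R)
    (hP : ∀ j, P.eval (h j) + (Matrix.vandermonde h).det * (x * r j) ∈ J) :
    ∃ g ∈ J, x ∣ g - P.coeff m := by
  set V := Matrix.vandermonde h with hV
  set Q : R[X] := ∏ j, (X - C (h j)) with hQ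
  have hQm : Q.Monic := monic_prod_of_monic _ _ fun j _ => monic_X_sub_C _
  have hQd : Q.natDegree = m + 1 := by
    rw [hQ, natDegree_prod_of_monic _ _ fun j _ => monic_X_sub_C _]
    simp
  -- `L` is the interpolation polynomial of `P` at the nodes: it has degree at most `m` and the same
  -- values there, even if nodes coincide.
  set L := P %ₘ Q with hL
  have hdiv : L + Q * (P /ₘ Q) = P := modByMonic_add_div P Q
  have hLd : L.natDegree < m + 1 := by
    rw [← hQd]
    refine natDegree_modByMonic_lt P hQm fun h1 => ?_
    rw [h1, natDegree_one] at hQd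
    omega
  have heval : ∀ j, P.eval (h j) = V.mulVec (fun i : Fin (m + 1) => L.coeff i) j := by
    intro j
    have hQj : Q.eval (h j) = 0 := by
      rw [hQ, eval_prod]
      exact Finset.prod_eq_zero (Finset.mem_univ j) (by simp)
    rw [← hdiv, eval_add, eval_mul, hQj, zero_mul, add_zero, eval_eq_sum_range' hLd,
      Finset.sum_range]
    refine Finset.sum_congr rfl fun i _ => ?_
    rw [mul_comm]
    rfl
  have hcramer : V.det * L.coeff m
      = ∑ j, V.adjugate (Fin.last m) j * P.eval (h j) := by
    have h1 := congrFun (congrArg (fun M => M.mulVec (fun i : Fin (m + 1) => L.coeff i))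
      (Matrix.adjugate_mul V)) (Fin.last m)
    simp only [← Matrix.mulVec_mulVec, Matrix.smul_mulVec, Matrix.one_mulVec, Pi.smul_apply,
      smul_eq_mul, Fin.val_last] at h1
    rw [← h1]
    simp only [heval]
    rfl
  -- By Cramer's rule, `V.det` times this element is a combination of the given members of `J`. The
  -- error terms carry the factor `V.det * x`, so after cancellation they still vanish modulo `x`.
  refine ⟨L.coeff m + x * ∑ j, V.adjugate (Fin.last m) j * r j, hJ _ ?_, ?_⟩
  · have : V.det * (L.coeff m + x * ∑ j, V.adjugate (Fin.last m) j * r j)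
        = ∑ j, V.adjugate (Fin.last m) j * (P.eval (h j) + V.det * (x * r j)) := by
      rw [mul_add, hcramer, Finset.mul_sum, Finset.mul_sum, ← Finset.sum_add_distrib]
      exact Finset.sum_congr rfl fun j _ => by ring
    rw [this]
    exact J.sum_mem fun j _ => J.mul_mem_left _ (hP j)
  -- All nodes vanish modulo `x`, so division by `Q` becomes truncation at degree `m + 1` and leaves
  -- the coefficient of degree `m` unchanged.
  · have hmap : Q.map (Ideal.Quotient.mk (Ideal.span {x})) = X ^ (m + 1) := by
      rw [hQ, Polynomial.map_prod]
      have : ∀ j, (X - C (h j)).map (Ideal.Quotient.mk (Ideal.span {x})) = X := fun j => by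
        rw [Polynomial.map_sub, map_X, map_C,
          Ideal.Quotient.eq_zero_iff_mem.2 (Ideal.mem_span_singleton.2 (hx j)), map_zero, sub_zero]
      simp [this]
    have hcoeff : x ∣ (Q * (P /ₘ Q)).coeff m := by
      rw [← Ideal.mem_span_singleton, ← Ideal.Quotient.eq_zero_iff_mem, ← coeff_map,
        Polynomial.map_mul, hmap, coeff_X_pow_mul', if_neg (by omega)]
    have hP2 : P.coeff m = L.coeff m + (Q * (P /ₘ Q)).coeff m := by rw [← coeff_add, hdiv]
    rw [hP2, show ∀ a b c : R, a + b - (a + c) = b - c by intros; ring]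
    exact dvd_sub (dvd_mul_right _ _) hcoeff

end Interpolation

/-! ### Expansion of a multivariate series along one variable. -/

section Expansion

open MvPowerSeries

variable {σ R : Type*} [CommRing R]

/-- A finite Taylor expansion in `X d`, obtained by repeatedly splitting off the terms free of `X d`
and dividing the rest by `X d`. Truncating at `N` makes the main part a genuine polynomial in `X d`.
-/
theorem exists_eq_sum_mul_X_pow_add (d : σ) (N : ℕ) (f : MvPowerSeries σ R) :
    ∃ (c : ℕ → MvPowerSeries σ R) (r : MvPowerSeries σ R),
      f = ∑ i ∈ Finset.range N, c i * X d ^ i + X d ^ N * r ∧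
      (∀ i s, s d ≠ 0 → coeff s (c i) = 0) ∧
      ∀ i < N, ∀ s : σ →₀ ℕ, s d = 0 → coeff s (c i) = coeff (s + Finsupp.single d i) f := by
  classical
  induction N generalizing f with
  | zero => exact ⟨0, f, by simp, by simp, by simp⟩
  | succ N ih =>
    let c₀ : MvPowerSeries σ R := fun s => if s d = 0 then coeff s f else 0
    have hc₀ : ∀ s, coeff s c₀ = if s d = 0 then coeff s f else 0 := fun s => rfl
    have hX : X d ∣ f - c₀ := X_dvd_iff.2 fun s hs => by rw [map_sub, hc₀, if_pos hs, sub_self]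
    obtain ⟨f₁, hf₁⟩ := hX
    have hshift : ∀ s, coeff (s + Finsupp.single d 1) f = coeff s f₁ := fun s => by
      have h1 : f = c₀ + X d * f₁ := by rw [← hf₁]; ring
      rw [h1, map_add, hc₀, if_neg (by simp), zero_add, add_comm s, X, coeff_add_monomial_mul,
        one_mul]
    obtain ⟨c, r, h1, h2, h3⟩ := ih f₁
    refine ⟨fun i => Nat.casesOn i c₀ c, r, ?_, ?_, ?_⟩
    · rw [Finset.sum_range_succ']
      have h4 : f = c₀ + X d * f₁ := by rw [← hf₁]; ring
      rw [h4, h1, mul_add, Finset.mul_sum]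
      have h5 : ∀ i, c i * X d ^ (i + 1) = X d * (c i * X d ^ i) := fun i => by ring
      simp only [h5]
      change _ = _ + c₀ * X d ^ 0 + _
      ring
    · rintro (_ | i) s hs
      · exact (hc₀ s).trans (if_neg hs)
      · exact h2 i s hs
    · rintro (_ | i) hi s hs
      · simpa [hs] using hc₀ s
      · refine (h3 i (by omega) s hs).trans ?_
        rw [← hshift, Finsupp.single_add, add_assoc]

theorem subst_eq_self_of_forall_coeff {a : σ → MvPowerSeries σ R} (ha : HasSubst a) {d : σ}
    (had : ∀ e ≠ d, a e = X e) {c : MvPowerSeries σ R} (hc : ∀ s, s d ≠ 0 → coeff s c = 0) :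
    subst a c = c := by
  conv_rhs => rw [← id_eq c, ← subst_self (R := R)]
  ext s
  rw [coeff_subst ha, coeff_subst HasSubst.X]
  refine finsum_congr fun t => ?_
  by_cases ht : t d = 0
  · congr 2
    refine Finset.prod_congr rfl fun e he => ?_
    have he' : e ≠ d := by
      rintro rfl
      exact Finsupp.mem_support_iff.1 he ht
    change a e ^ t e = X e ^ t e
    rw [had e he']
  · rw [hc t ht, zero_smul, zero_smul]

end Expansion

/-! ### Rigidity of scalar series modulo the uniformizer. -/

section Bracket

open PowerSeries

variable {R : Type*} [CommRing R]

theorem C_dvd_iff {a : R} {f : R⟦X⟧} : (C a : R⟦X⟧) ∣ f ↔ ∀ n, a ∣ PowerSeries.coeff n f := by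
  refine ⟨?_, fun h => ?_⟩
  · rintro ⟨g, rfl⟩ n
    rw [coeff_C_mul]
    exact dvd_mul_right _ _
  · choose c hc using h
    refine ⟨PowerSeries.mk c, ?_⟩
    ext n
    rw [coeff_C_mul, coeff_mk, hc]

theorem C_dvd_iff_map_eq_zero {a : R} {f : R⟦X⟧} :
    (C a : R⟦X⟧) ∣ f ↔ PowerSeries.map (Ideal.Quotient.mk (Ideal.span {a})) f = 0 := by
  simp only [C_dvd_iff, PowerSeries.ext_iff, coeff_map, map_zero, Ideal.Quotient.eq_zero_iff_mem,
    Ideal.mem_span_singleton]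

theorem map_subst_of_constantCoeff_eq_zero {S : Type*} [CommRing S] (φ : R →+* S) {f : R⟦X⟧}
    (hf : PowerSeries.constantCoeff f = 0) (Ψ : R⟦X⟧) :
    PowerSeries.map φ (Ψ.subst f) = (PowerSeries.map φ Ψ).subst (PowerSeries.map φ f) :=
  PowerSeries.map_subst (HasSubst.of_constantCoeff_zero' hf) Ψ

theorem C_dvd_subst_sub {a : R} (Ψ : R⟦X⟧) {f g : R⟦X⟧} (hf : PowerSeries.constantCoeff f = 0)
    (hg : PowerSeries.constantCoeff g = 0) (h : (C a : R⟦X⟧) ∣ f - g) :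
    (C a : R⟦X⟧) ∣ Ψ.subst f - Ψ.subst g := by
  rw [C_dvd_iff_map_eq_zero, map_sub, sub_eq_zero] at h ⊢
  rw [map_subst_of_constantCoeff_eq_zero _ hf, map_subst_of_constantCoeff_eq_zero _ hg, h]

/-- Raising to the `q`-th power gains a factor `π`: the cofactor of `f - g` in `f ^ q - g ^ q`
reduces to `q * f ^ (q - 1)` modulo `π`, and `q = 0` in `R / π`. -/
theorem C_mul_dvd_pow_card_sub {a π : R} {f g : R⟦X⟧} (ha : π ∣ a)
    (h : (C a : R⟦X⟧) ∣ f - g) :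
    (C (a * π) : R⟦X⟧) ∣
      f ^ Nat.card (R ⧸ Ideal.span {π}) - g ^ Nat.card (R ⧸ Ideal.span {π}) := by
  rw [← geom_sum₂_mul, map_mul, mul_comm]
  refine mul_dvd_mul ?_ h
  have h1 := (map_dvd C ha).trans h
  rw [C_dvd_iff_map_eq_zero, map_sub, sub_eq_zero] at h1
  rw [C_dvd_iff_map_eq_zero, map_sum]
  simp only [map_mul, map_pow, h1]
  rw [geom_sum₂_self]
  have hq : ((Nat.card (R ⧸ Ideal.span {π}) : ℕ) : R ⧸ Ideal.span {π}) = 0 := by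
    -- An infinite quotient has `Nat.card` equal to `0`, so the claim holds there as well.
    cases finite_or_infinite (R ⧸ Ideal.span {π})
    · have := Fintype.ofFinite (R ⧸ Ideal.span {π})
      rw [Nat.card_eq_fintype_card, Nat.cast_card_eq_zero]
    · rw [Nat.card_eq_zero_of_infinite, Nat.cast_zero]
  rw [← map_natCast (C (R := R ⧸ Ideal.span {π})), hq, map_zero, zero_mul]

theorem IsFrobeniusSeries.exists_eq {π : R} {Φ : R⟦X⟧} (hΦ : IsFrobeniusSeries π Φ) :
    ∃ Ψ : R⟦X⟧, Φ = X ^ Nat.card (R ⧸ Ideal.span {π}) + C π * Ψ := by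
  obtain ⟨Ψ, hΨ⟩ := C_dvd_iff.2 fun n => Ideal.mem_span_singleton.1 (hΦ.coeff_modEq n)
  exact ⟨Ψ, by rw [← hΨ]; ring⟩

theorem IsFrobeniusSeries.C_mul_dvd_subst_sub {π : R} {Φ : R⟦X⟧} (hΦ : IsFrobeniusSeries π Φ)
    {a : R} (ha : π ∣ a) {f g : R⟦X⟧} (hf : PowerSeries.constantCoeff f = 0)
    (hg : PowerSeries.constantCoeff g = 0) (h : (C a : R⟦X⟧) ∣ f - g) :
    (C (a * π) : R⟦X⟧) ∣ Φ.subst f - Φ.subst g := by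
  obtain ⟨Ψ, hΨ⟩ := hΦ.exists_eq
  have key : ∀ f : R⟦X⟧, PowerSeries.constantCoeff f = 0 → (Φ.subst f : R⟦X⟧)
      = f ^ Nat.card (R ⧸ Ideal.span {π}) + C π * Ψ.subst f := fun f hf => by
    have sf : HasSubst f := HasSubst.of_constantCoeff_zero' hf
    conv_lhs => rw [hΨ]
    rw [subst_add sf, subst_mul sf, subst_pow sf, subst_X sf]
    congr 2
    exact subst_C π
  rw [key f hf, key g hg, add_sub_add_comm, ← mul_sub]
  refine dvd_add (C_mul_dvd_pow_card_sub ha h) ?_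
  rw [map_mul, mul_comm]
  exact mul_dvd_mul_left _ (C_dvd_subst_sub Ψ hf hg h)

/-- Congruence modulo `π` improves itself. If `f - g = π ^ n * w` with `n ≥ 1`, then `Φ(f) - Φ(g)`
is divisible by `π ^ (n + 1)`; it also equals `π ^ n * w(Φ)`, so `π` divides `w(Φ)`. Modulo `π` this
reads `w(t ^ q) = w ^ q = 0`, whence `π` divides `w`. Thus `f - g` is divisible by all powers of
`π`, and Krull's intersection theorem applies to the linear coefficients. -/
theorem eq_of_C_dvd_sub [IsDomain R] [IsNoetherianRing R] {π : R} (h0 : π ≠ 0)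
    [hmax : (Ideal.span {π}).IsMaximal] [Finite (R ⧸ Ideal.span {π})] {Φ : R⟦X⟧}
    (hΦ : IsFrobeniusSeries π Φ) {a b : R} {f g : R⟦X⟧} (hf : IsScalarSeries Φ a f)
    (hg : IsScalarSeries Φ b g) (h : (C π : R⟦X⟧) ∣ f - g) : a = b := by
  let := Ideal.Quotient.field (Ideal.span {π})
  have sΦ : HasSubst Φ := HasSubst.of_constantCoeff_zero' hΦ.constantCoeff_eq
  have hmapΦ : PowerSeries.map (Ideal.Quotient.mk (Ideal.span {π})) Φ
      = X ^ Nat.card (R ⧸ Ideal.span {π}) := by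
    obtain ⟨Ψ, hΨ⟩ := hΦ.exists_eq
    have h1 := C_dvd_iff_map_eq_zero.1 (Dvd.intro Ψ rfl : (C π : R⟦X⟧) ∣ C π * Ψ)
    conv_lhs => rw [hΨ, map_add, h1, add_zero, map_pow, PowerSeries.map_X]
  have main : ∀ n, (C (π ^ (n + 1)) : R⟦X⟧) ∣ f - g := fun n => by
    induction n with
    | zero => rwa [zero_add, pow_one]
    | succ n ih =>
      obtain ⟨w, hw⟩ := ih
      have h1 := hΦ.C_mul_dvd_subst_sub (dvd_pow_self π n.succ_ne_zero) hf.constantCoeff_eq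
        hg.constantCoeff_eq ⟨w, hw⟩
      have h2 : (f.subst Φ - g.subst Φ : R⟦X⟧) = C (π ^ (n + 1)) * w.subst Φ := by
        rw [← coe_substAlgHom sΦ, ← map_sub, hw, map_mul, coe_substAlgHom]
        congr 1
        exact subst_C _
      rw [hf.comm, hg.comm, h2, map_mul,
        mul_dvd_mul_iff_left ((map_ne_zero_iff _ C_injective).2 (pow_ne_zero _ h0)),
        C_dvd_iff_map_eq_zero,
        map_subst_of_constantCoeff_eq_zero _ hΦ.constantCoeff_eq, hmapΦ, subst_X_pow_card] at h1
      have h3 := C_dvd_iff_map_eq_zero.2 (eq_zero_of_pow_eq_zero h1)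
      rw [hw, pow_succ, map_mul]
      exact mul_dvd_mul_left _ h3
  have h4 : a - b ∈ ⨅ n : ℕ, Ideal.span {π} ^ n := by
    rw [Ideal.mem_iInf]
    rintro (_ | n)
    · simp
    · rw [Ideal.span_singleton_pow, Ideal.mem_span_singleton, ← hf.coeff_one_eq,
        ← hg.coeff_one_eq, ← map_sub]
      exact C_dvd_iff.1 (main n) 1
  rw [Ideal.iInf_pow_eq_bot_of_isDomain _ hmax.ne_top, Ideal.mem_bot, sub_eq_zero] at h4
  exact h4

end Bracket

/-! ### Units with distinct reduced series. -/

section Padic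

variable {p : ℕ} [Fact p.Prime] {F : Type*} [Field F] [Algebra ℚ_[p] F] [FiniteDimensional ℚ_[p] F]
  [Algebra ℤ_[p] F] [IsScalarTower ℤ_[p] ℚ_[p] F] {π : integralClosure ℤ_[p] F}
  (hπ : Irreducible π) {Φ : PowerSeries (integralClosure ℤ_[p] F)} (hΦ : IsFrobeniusSeries π Φ)
  {k : Type*} [Field k] (ι : integralClosure ℤ_[p] F →+* k)

theorem map_bracket_injective : Function.Injective fun a : integralClosure ℤ_[p] F =>
    PowerSeries.map ι (bracket hπ hΦ a) := by
  intro a b hab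
  have := isDiscreteValuationRing p F
  obtain ⟨hmax, hfin⟩ := isMaximal_and_finite p F hπ
  refine eq_of_C_dvd_sub hπ.ne_zero hΦ (bracket_spec hπ hΦ a) (bracket_spec hπ hΦ b) ?_
  rw [C_dvd_iff]
  intro n
  have h1 := congrArg (PowerSeries.coeff n) hab
  simp only [PowerSeries.coeff_map] at h1
  -- An element killed by `ι` is not a unit, so it lies in the maximal ideal `(π)`; equality over
  -- `k` therefore gives congruence modulo `π`.
  rw [← Ideal.mem_span_singleton, IsLocalRing.eq_maximalIdeal hmax, IsLocalRing.mem_maximalIdeal,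
    mem_nonunits_iff, map_sub]
  intro hu
  have h2 := hu.map ι
  rw [map_sub, h1, sub_self] at h2
  exact not_isUnit_zero h2

theorem exists_injective_units {π : integralClosure ℤ_[p] F} (hπ : Irreducible π) :
    ∃ γ : ℕ → (integralClosure ℤ_[p] F)ˣ, Function.Injective γ := by
  have := isLocalRing_integralClosure p F
  have hu : ∀ n : ℕ, IsUnit (1 - π ^ (n + 1)) := fun n => by
    refine (IsLocalRing.isUnit_or_isUnit_one_sub_self (π ^ (n + 1))).resolve_left ?_
    rw [isUnit_pow_iff n.succ_ne_zero]
    exact hπ.not_isUnit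
  refine ⟨fun n => (hu n).unit, fun i j hij => ?_⟩
  have h1 : (1 : integralClosure ℤ_[p] F) - π ^ (i + 1) = 1 - π ^ (j + 1) :=
    congrArg Units.val hij
  have h2 := pow_injective_of_not_isUnit hπ.not_isUnit hπ.ne_zero (sub_right_injective h1)
  exact Nat.succ_injective h2

/-! ### Eliminating the variables one by one. -/

variable {D : Type*} [Fintype D]

theorem powerSeriesAction_X (γ : D → (integralClosure ℤ_[p] F)ˣ) (d : D) :
    powerSeriesAction hπ hΦ ι γ (MvPowerSeries.X d : MvPowerSeries D k)
      = imageVar hπ hΦ ι (γ d) d :=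
  MvPowerSeries.substAlgHom_X (hasSubst_imageVar hπ hΦ ι γ) d

theorem powerSeriesAction_eq_self {γ : D → (integralClosure ℤ_[p] F)ˣ} {d : D}
    (hγ : ∀ e ≠ d, γ e = 1) {c : MvPowerSeries D k}
    (hc : ∀ s, s d ≠ 0 → MvPowerSeries.coeff s c = 0) : powerSeriesAction hπ hΦ ι γ c = c := by
  change MvPowerSeries.substAlgHom (hasSubst_imageVar hπ hΦ ι γ) c = c
  rw [MvPowerSeries.coe_substAlgHom]
  refine subst_eq_self_of_forall_coeff (hasSubst_imageVar hπ hΦ ι γ) (d := d) (fun e he => ?_) hc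
  rw [hγ e he, imageVar, Units.val_one, bracket_one, PowerSeries.map_X,
    PowerSeries.subst_X (PowerSeries.HasSubst.X e)]

/-- The interpolation argument for one variable. The other entries of `e` are untouched, so the
lemma can be iterated over `D`. -/
theorem exists_mem_coeff_erase_ne_zero {J : Ideal (MvPowerSeries D k)}
    (hJ : ∀ γ : D → (integralClosure ℤ_[p] F)ˣ, ∀ f ∈ J, powerSeriesAction hπ hΦ ι γ f ∈ J)
    {d : D} (hX : ∀ g, MvPowerSeries.X d * g ∈ J → g ∈ J) {f : MvPowerSeries D k} (hf : f ∈ J)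
    {e : D →₀ ℕ} (he : MvPowerSeries.coeff e f ≠ 0) :
    ∃ g ∈ J, MvPowerSeries.coeff (e.erase d) g ≠ 0 := by
  classical
  obtain ⟨γ, hγ⟩ := exists_injective_units hπ
  have sX : PowerSeries.HasSubst (MvPowerSeries.X d : MvPowerSeries D k) :=
    PowerSeries.HasSubst.X d
  -- The determinant is computed in `k[[t]]`, where every nonzero series is a power of `t` times a
  -- unit, and carried to `k[[t_•]]` along `ψ`.
  let ψ := (PowerSeries.substAlgHom (R := k) sX).toRingHom
  have hψX : ψ PowerSeries.X = MvPowerSeries.X d := PowerSeries.substAlgHom_X sX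
  set m := e d with hm
  let h₀ : Fin (m + 1) → PowerSeries k := fun j => PowerSeries.map ι (bracket hπ hΦ (γ j))
  let h : Fin (m + 1) → MvPowerSeries D k := fun j => imageVar hπ hΦ ι (γ j) d
  have hh : ∀ j, ψ (h₀ j) = h j := fun j => by
    change PowerSeries.substAlgHom sX _ = _
    rw [PowerSeries.coe_substAlgHom]
    rfl
  have hδ : (Matrix.vandermonde h₀).det ≠ 0 :=
    Matrix.det_vandermonde_ne_zero_iff.2 fun i j hij =>
      Fin.ext (hγ (Units.ext (map_bracket_injective hπ hΦ ι hij)))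
  have hΔ : (Matrix.vandermonde h).det = ψ (Matrix.vandermonde h₀).det := by
    rw [RingHom.map_det]
    congr 1
    ext1 i j
    simp [Matrix.vandermonde_apply, hh]
  obtain ⟨a, u, hu, hau⟩ : ∃ (a : ℕ) (u : MvPowerSeries D k), IsUnit u ∧
      (Matrix.vandermonde h).det = MvPowerSeries.X d ^ a * u := by
    refine ⟨(Matrix.vandermonde h₀).det.order.toNat,
      ψ (PowerSeries.Unit_of_divided_by_X_pow_order (Matrix.vandermonde h₀).det),
      (Units.isUnit _).map ψ, ?_⟩
    rw [hΔ, PowerSeries.Unit_of_divided_by_X_pow_order_nonzero hδ, ← hψX, ← map_pow, ← map_mul,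
      PowerSeries.X_pow_order_mul_divXPowOrder]
  obtain ⟨u', hu'⟩ := hu.exists_right_inv
  have hXpow : ∀ n g, MvPowerSeries.X d ^ n * g ∈ J → g ∈ J := fun n => by
    induction n with
    | zero => intro g hg; simpa using hg
    | succ n ih => exact fun g hg => ih g (hX _ (by rwa [← mul_assoc, ← pow_succ']))
  -- The truncation order has three parts: `a` powers of `X d` absorb the determinant, one more
  -- supplies the factor `x` of the error term, and `m + 1` ensure that `c m` is among the
  -- coefficients.
  obtain ⟨c, r, hfe, hc1, hc2⟩ := exists_eq_sum_mul_X_pow_add d (a + 1 + (m + 1)) f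
  set N := a + 1 + (m + 1) with hN
  choose v _ hv using fun j : Fin (m + 1) => exists_imageVar_eq (D := D) hπ hΦ ι (γ j) d
  let P : Polynomial (MvPowerSeries D k) :=
    ∑ i ∈ Finset.range N, Polynomial.C (c i) * Polynomial.X ^ i
  have hPm : P.coeff m = c m := by
    rw [Polynomial.finsetSum_coeff, Finset.sum_eq_single m]
    · simp
    · intro i _ hi
      rw [Polynomial.coeff_C_mul, Polynomial.coeff_X_pow, if_neg (Ne.symm hi), mul_zero]
    · intro hmN
      exact absurd (Finset.mem_range.2 (by omega)) hmN
  let σ : Fin (m + 1) → MvPowerSeries D k →+* MvPowerSeries D k := fun j =>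
    powerSeriesAction hπ hΦ ι (Function.update 1 d (γ j))
  have hσX : ∀ j, σ j (MvPowerSeries.X d) = h j := fun j => by
    rw [powerSeriesAction_X, Function.update_self]
  have hσc : ∀ j i, σ j (c i) = c i := fun j i =>
    powerSeriesAction_eq_self hπ hΦ ι (d := d)
      (fun e he => by rw [Function.update_of_ne he, Pi.one_apply]) (hc1 i)
  obtain ⟨g, hg, hgd⟩ := exists_mem_dvd_sub_coeff (J := J) (x := MvPowerSeries.X d) h
    (fun j => ⟨v j, hv j⟩)
    (fun g hg => by
      rw [hau, mul_assoc] at hg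
      have h1 := J.mul_mem_left u' (hXpow _ _ hg)
      rwa [← mul_assoc, mul_comm u', hu', one_mul] at h1)
    -- This rewrites the remainder `h j ^ N * σ j r` as determinant times `X d` times a cofactor,
    -- using `h j = X d * v j` and the inverse `u'` of the unit part.
    P (fun j => u' * MvPowerSeries.X d ^ (m + 1) * v j ^ N * σ j r) (fun j => by
      convert hJ (Function.update 1 d (γ j)) f hf using 1
      change _ = σ j f
      rw [hfe, map_add, map_mul, map_pow, map_sum, hσX, Polynomial.eval_finsetSum]
      congr 1
      · refine Finset.sum_congr rfl fun i _ => ?_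
        rw [map_mul, map_pow, hσX, hσc]
        simp
      · have h1 : h j = MvPowerSeries.X d * v j := hv j
        rw [hau, h1, mul_pow, hN]
        linear_combination (MvPowerSeries.X d ^ (a + 1 + (m + 1)) * v j ^ (a + 1 + (m + 1))
          * σ j r) * hu')
  refine ⟨g, hg, ?_⟩
  -- The exponent `e.erase d` does not involve `d`, so `g` and `c m` agree there, and for `c m` this
  -- coefficient is that of `f` at `e`.
  have h1 := MvPowerSeries.X_dvd_iff.1 hgd (e.erase d) Finsupp.erase_same
  rw [map_sub, sub_eq_zero, hPm, hc2 m (by omega) _ Finsupp.erase_same, hm,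
    Finsupp.erase_add_single] at h1
  rwa [h1]

theorem eq_top_of_exists_ne_zero {J : Ideal (MvPowerSeries D k)}
    (hJ : ∀ γ : D → (integralClosure ℤ_[p] F)ˣ, ∀ f ∈ J, powerSeriesAction hπ hΦ ι γ f ∈ J)
    (hX : ∀ d g, MvPowerSeries.X d * g ∈ J → g ∈ J) {f : MvPowerSeries D k} (hf : f ∈ J)
    (hf0 : f ≠ 0) : J = ⊤ := by
  classical
  obtain ⟨e, he⟩ := MvPowerSeries.ne_zero_iff_exists_coeff_ne_zero f |>.1 hf0
  have main : ∀ s : Finset D, ∃ g ∈ J, ∃ e' : D →₀ ℕ, (∀ d ∈ s, e' d = 0) ∧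
      MvPowerSeries.coeff e' g ≠ 0 := fun s => by
    induction s using Finset.induction_on with
    | empty => exact ⟨f, hf, e, by simp, he⟩
    | insert d s _ ih =>
      obtain ⟨g, hg, e', he', hge⟩ := ih
      obtain ⟨g', hg', hge'⟩ := exists_mem_coeff_erase_ne_zero hπ hΦ ι hJ (hX d) hg hge
      refine ⟨g', hg', e'.erase d, fun i hi => ?_, hge'⟩
      by_cases hid : i = d
      · rw [hid, Finsupp.erase_same]
      · rw [Finsupp.erase_ne hid]
        exact he' i ((Finset.mem_insert.1 hi).resolve_left hid)
  obtain ⟨g, hg, e', he', hge⟩ := main Finset.univ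
  obtain rfl : e' = 0 := Finsupp.ext fun d => he' d (Finset.mem_univ d)
  exact Ideal.eq_top_of_isUnit_mem J hg
    (MvPowerSeries.isUnit_iff_constantCoeff.2 (isUnit_iff_ne_zero.2 hge))

end Padic
end LubinTate

/-! ### Passage from `k[[t_•]]` to its localization. -/

theorem mainTheorem1 (p : ℕ) [Fact p.Prime] (F : Type*) [Field F] [Algebra ℚ_[p] F]
    [FiniteDimensional ℚ_[p] F] [Algebra ℤ_[p] F] [IsScalarTower ℤ_[p] ℚ_[p] F]
    (π : integralClosure ℤ_[p] F) (hπ : Irreducible π)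
    (Φ : PowerSeries (integralClosure ℤ_[p] F)) (hΦ : LubinTate.IsFrobeniusSeries π Φ)
    (k : Type*) [Field k] [CharP k p] (ι : integralClosure ℤ_[p] F →+* k)
    (D : Type*) [Fintype D]
    (I : Ideal (LubinTate.LaurentRing k D))
    (hI : ∀ γ : D → (integralClosure ℤ_[p] F)ˣ, ∀ x ∈ I, LubinTate.action hπ hΦ ι γ x ∈ I) :
    I = ⊥ ∨ I = ⊤ := by
  refine or_iff_not_imp_left.2 fun hbot => ?_
  set t : MvPowerSeries D k := ∏ d, MvPowerSeries.X d with ht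
  let J : Ideal (MvPowerSeries D k) :=
    I.comap (algebraMap (MvPowerSeries D k) (LubinTate.LaurentRing k D))
  have hmap : J.map (algebraMap (MvPowerSeries D k) (LubinTate.LaurentRing k D)) = I :=
    IsLocalization.map_under (Submonoid.powers t) _ I
  -- Ideals of a localization are extended from their contractions, so `J` is nonzero when `I` is,
  -- and `J = ⊤` suffices.
  have hJ0 : J ≠ ⊥ := fun h => hbot (by rw [← hmap, h, Ideal.map_bot])
  obtain ⟨f, hf, hf0⟩ := Submodule.exists_mem_ne_zero_of_ne_bot hJ0
  have hJ : J = ⊤ := by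
    refine LubinTate.eq_top_of_exists_ne_zero hπ hΦ ι (fun γ g hg => ?_) (fun d g hg => ?_) hf hf0
    · have h1 := hI γ _ hg
      rw [show LubinTate.action hπ hΦ ι γ (algebraMap _ (LubinTate.LaurentRing k D) g)
        = algebraMap _ (LubinTate.LaurentRing k D) (LubinTate.powerSeriesAction hπ hΦ ι γ g) from
          IsLocalization.Away.lift_eq _ (LubinTate.isUnit_algebraMap_powerSeriesAction hπ hΦ ι γ) g]
        at h1
      exact h1
    -- Each `X d` divides the inverted product, hence is a unit in the localization and can be
    -- cancelled modulo `J`.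
    · have hu : IsUnit (algebraMap (MvPowerSeries D k) (LubinTate.LaurentRing k D)
          (MvPowerSeries.X d)) :=
        isUnit_of_dvd_unit (map_dvd _ (Finset.dvd_prod_of_mem _ (Finset.mem_univ d)))
          (IsLocalization.Away.algebraMap_isUnit t)
      have h1 : algebraMap (MvPowerSeries D k) (LubinTate.LaurentRing k D)
        (MvPowerSeries.X d * g) ∈ I := hg
      rw [map_mul, Ideal.unit_mul_mem_iff_mem _ hu] at h1
      exact h1
  rw [← hmap, hJ, Ideal.map_top]
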